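/- Let $(X,d)$ be a complete metric space, $s\ge 2$, $S=\{1,\dots,s\}$, let $F_1,\dots,F_s:X\to X$ be contractions, and let $K\subset X$ be their self-similar set, i.e. the unique non-empty compact set with $K=\bigcup_{i}F_iK$. Each $F_i$ is assumed injective on $K$, as is usual for self-similar structures. For words $w=w_1\cdots w_m$ put $F_w=F_{w_1}\circ\cdots\circ F_{w_m}$. Let $\Pi:S^{\mathbb N}\to K$, $\{\Pi(\omega)\}=\bigcap_{m\ge1} F_{\omega_1\cdots\omega_m}K$, let $\mathscr C=\Pi^{-1}\big(\bigcup_{i\ne j}F_iK\cap F_jK\big)$ and $\mathscr P=\bigcup_{m\ge1}\sigma^m(\mathscr C)$, where $\sigma$ is the left shift. Assume that $K$ is connected and post-critically finite, i.e. $\mathscr P$ is finite. Put $V_0=\Pi(\mathscr P)$ and $V_m=\bigcup_{|w|=m}F_wV_0$. Let $(H_0,\mathbf r)$ be a regular harmonic structure: $H_0$ is a symmetric non-positive definite real matrix indexed by $V_0$, whose kernel consists exactly of the constants and whose off-diagonal entries are non-negative; $0<r_i<1$ for all $i$; and, with $\mathscr E_m(u)=\sum_{|w|=m}r_w^{-1}\mathscr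 E_0(u\circ F_w|_{V_0})$, $\mathscr E_0(v)=-v^{\mathrm t}H_0v$, $r_w=r_{w_1}\cdots r_{w_m}$, one has $\mathscr E_0(v)=\min\{\mathscr E_1(u):u|_{V_0}=v\}$ for every $v:V_0\to\mathbb R$. Let $\mathscr E(u)=\lim_m\mathscr E_m(u)$ and let $\mathscr F$ be the set of $u\in C(K)$ with $\mathscr E(u)<\infty$. Let $\mu$ be the self-similar probability measure $\mu=\sum_i\mu_i\,\mu\circ F_i^{-1}$ with weights $\mu_i\in(0,1)$, $\sum_i\mu_i=1$. Let $H_m=\sum_{|w|=m}r_w^{-1}R_w^{\mathrm t}H_0R_w$, $R_wu=u\circ F_w|_{V_0}$; for $p\in V_m$ let $\psi_{m,p}$ be the minimizer of $\mathscr E$ among the $u\in\mathscr F$ with $u(p)=1$ and $u=0$ on $V_m\setminus\{p\}$, and put $\mu_{m,p}=\int_K\psi_{m,p}\,d\mu$. For $u,f\in C(K)$ one writes $\Delta_\mu u=f$ if $\max_{p\in V_m\setminus V_0}|\mu_{m,p}^{-1}(H_mu)(p)-f(p)|\to0$ as $m\to\infty$. For $\lambda\ge0$, a $\lambda$-eigenfunction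 is a function $u\not\equiv0$ in the domain of $\Delta_\mu$ with $-\Delta_\mu u=\lambda u$ on $K\setminus V_0$ (no boundary condition). The spectral exponent $d_S$ is the unique real number with $\sum_i(r_i\mu_i)^{d_S/2}=1$. An extreme set of $u\in C(K)$ is a non-empty set $A\subset K$ such that, for some $c\in\mathbb R$: $A$ is a connected component of $u^{-1}(c)$, $A\cap V_0=\emptyset$, and for some $\delta>0$ either $u\le c$ on the $\delta$-neighbourhood of $A$ in $K$, or $u\ge c$ there. Let $N(u)\in\{0,1,\dots,\infty\}$ be the number of extreme sets of $u$ and, for $x>0$, $$N(x)=\sup\{N(u):u\text{ is a }\lambda\text{-eigenfunction for some }0\le\lambda\le x\}.$$ Proposition. Assume condition (A): there is $\lambda_0>0$ such that $N(u)\le1$ for every $\lambda$-eigenfunction $u$ with $0\le\lambda<\lambda_0$. Then $$\limsup_{x\to\infty}\frac{N(x)}{x^{d_S/2}}<\infty .$$ -/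

import Mathlib

open Set Filter Topology MeasureTheory
open scoped NNReal ENNReal Matrix

noncomputable section

/-- An iterated function system `F 0, …, F (s-1)` of contractions of the metric space `X`, with
`s ≥ 2`, together with its self-similar set: the non-empty compact set `K` with `K = ⋃ i, F i K`
(unique when `X` is complete). As always in the theory of self-similar structures, every `F i`
is injective on `K`. -/
structure SelfSimilarSet (X : Type*) [MetricSpace X] (s : ℕ) where
  two_le : 2 ≤ s
  F : Fin s → X → X
  contracting : ∀ i, ∃ c : ℝ≥0, ContractingWith c (F i)
  K : Set X
  isCompact : IsCompact K
  nonempty : K.Nonempty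
  eq_iUnion : K = ⋃ i, F i '' K
  injOn : ∀ i, InjOn (F i) K

namespace SelfSimilarSet

variable {X : Type*} [MetricSpace X] {s : ℕ} (S : SelfSimilarSet X s)

theorem mapsTo (i : Fin s) : MapsTo (S.F i) S.K S.K := fun x hx => by
  rw [S.eq_iUnion]
  exact mem_iUnion.2 ⟨i, mem_image_of_mem _ hx⟩

/-- The restriction of `F i` to a self-map of `K`. -/
def map (i : Fin s) : S.K → S.K := (S.mapsTo i).restrict

/-- `F_w = F_{w 0} ∘ ⋯ ∘ F_{w (m-1)}` on `K`, for a word `w` of length `m`. -/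
def wordMap : {m : ℕ} → (Fin m → Fin s) → S.K → S.K
  | 0, _ => id
  | _ + 1, w => S.map (w 0) ∘ wordMap (Fin.tail w)

theorem continuous_map (i : Fin s) : Continuous (S.map i) := by
  obtain ⟨c, hc⟩ := S.contracting i
  exact (hc.toLipschitzWith.continuous.comp continuous_subtype_val).subtype_mk _

theorem continuous_wordMap {m : ℕ} (w : Fin m → Fin s) : Continuous (S.wordMap w) := by
  induction m with
  | zero => exact continuous_id
  | succ m ih => exact (S.continuous_map _).comp (ih _)

theorem wordMap_truncate_succ (m : ℕ) (ω : ℕ → Fin s) :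
    S.wordMap (fun k : Fin (m + 1) => ω k) =
      S.wordMap (fun k : Fin m => ω k) ∘ S.map (ω m) := by
  induction m generalizing ω with
  | zero => rfl
  | succ m ih =>
    have h := ih (fun n => ω (n + 1))
    have e1 : S.wordMap (fun k : Fin (m + 1 + 1) => ω k) =
        S.map (ω 0) ∘ S.wordMap (fun k : Fin (m + 1) => ω (k + 1)) := rfl
    have e2 : S.wordMap (fun k : Fin (m + 1) => ω k) =
        S.map (ω 0) ∘ S.wordMap (fun k : Fin m => ω (k + 1)) := rfl
    rw [e1, e2, h]
    rfl

theorem exists_ratio : ∃ c : ℝ, 0 ≤ c ∧ c < 1 ∧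
    ∀ i x y, dist (S.map i x) (S.map i y) ≤ c * dist x y := by
  choose c hc using S.contracting
  have hs : (Finset.univ : Finset (Fin s)).Nonempty :=
    ⟨⟨0, lt_of_lt_of_le two_pos S.two_le⟩, Finset.mem_univ _⟩
  refine ⟨(Finset.univ.sup' hs c : ℝ≥0), NNReal.coe_nonneg _, ?_, fun i x y => ?_⟩
  · have : Finset.univ.sup' hs c < 1 := (Finset.sup'_lt_iff hs).2 fun i _ => (hc i).1
    exact_mod_cast this
  · have h1 := (hc i).toLipschitzWith.dist_le_mul (x : X) y
    have h2 : c i ≤ Finset.univ.sup' hs c := Finset.le_sup' c (Finset.mem_univ i)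
    exact h1.trans (mul_le_mul_of_nonneg_right (by exact_mod_cast h2) dist_nonneg)

/-- For every infinite word `ω` the cells `F_{[ω]_m} K` shrink to exactly one point. -/
theorem existsUnique_coding (ω : ℕ → Fin s) :
    ∃! x : S.K, ∀ m : ℕ, x ∈ range (S.wordMap fun k : Fin m => ω k) := by
  have : CompactSpace S.K := isCompact_iff_compactSpace.1 S.isCompact
  have : Nonempty S.K := S.nonempty.to_subtype
  have hcomp : ∀ m : ℕ, IsCompact (range (S.wordMap fun k : Fin m => ω k)) :=
    fun m => isCompact_range (S.continuous_wordMap _)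
  obtain ⟨x, hx⟩ := IsCompact.nonempty_iInter_of_sequence_nonempty_isCompact_isClosed
    (fun m : ℕ => range (S.wordMap fun k : Fin m => ω k))
    (fun m => by
      rw [S.wordMap_truncate_succ]
      exact range_comp_subset_range _ _)
    (fun m => range_nonempty _) (hcomp 0) (fun m => (hcomp m).isClosed)
  rw [mem_iInter] at hx
  refine ⟨x, hx, fun y hy => ?_⟩
  obtain ⟨c, hc0, hc1, hc⟩ := S.exists_ratio
  have hw : ∀ (m : ℕ) (w : Fin m → Fin s) (a b : S.K),
      dist (S.wordMap w a) (S.wordMap w b) ≤ c ^ m * dist a b := by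
    intro m
    induction m with
    | zero => intro w a b; simp [wordMap]
    | succ m ih =>
      intro w a b
      calc dist (S.wordMap w a) (S.wordMap w b)
          ≤ c * dist (S.wordMap (Fin.tail w) a) (S.wordMap (Fin.tail w) b) := hc _ _ _
        _ ≤ c * (c ^ m * dist a b) := mul_le_mul_of_nonneg_left (ih _ _ _) hc0
        _ = c ^ (m + 1) * dist a b := by ring
  have hb : ∀ m : ℕ, dist y x ≤ c ^ m * Metric.diam (univ : Set S.K) := by
    intro m
    obtain ⟨a, ha⟩ := hy m
    obtain ⟨b, hb⟩ := hx m
    rw [← ha, ← hb]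
    exact (hw m _ a b).trans (mul_le_mul_of_nonneg_left
      (Metric.dist_le_diam_of_mem isCompact_univ.isBounded (mem_univ _) (mem_univ _))
      (pow_nonneg hc0 m))
  have hlim : Tendsto (fun m : ℕ => c ^ m * Metric.diam (univ : Set S.K)) atTop (𝓝 0) := by
    simpa using (tendsto_pow_atTop_nhds_zero_of_lt_one hc0 hc1).mul_const _
  exact dist_le_zero.1 (ge_of_tendsto' hlim hb)

/-- The coding map `Π` from infinite words to `K`: `Π ω` is the only point of
`⋂ m, F_{[ω]_m} K`. -/
def coding (ω : ℕ → Fin s) : S.K := (S.existsUnique_coding ω).choose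

/-- The critical set `Π⁻¹(⋃_{i ≠ j} F_i K ∩ F_j K)`. -/
def criticalSet : Set (ℕ → Fin s) :=
  {ω | ∃ i j, i ≠ j ∧ S.coding ω ∈ range (S.map i) ∩ range (S.map j)}

/-- The post-critical set `⋃_{m ≥ 1} σ^m(C)`, where `σ` is the left shift. -/
def postCriticalSet : Set (ℕ → Fin s) :=
  {τ | ∃ m : ℕ, 1 ≤ m ∧ ∃ ω ∈ S.criticalSet, τ = fun n => ω (n + m)}

/-- The boundary `V₀ = Π(P)`. -/
def V0 : Set S.K := S.coding '' S.postCriticalSet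

/-- The vertices `V_m = ⋃_{|w| = m} F_w V₀` of level `m`. -/
def V (m : ℕ) : Set S.K := ⋃ w : Fin m → Fin s, S.wordMap w '' S.V0

end SelfSimilarSet

/-- A connected post-critically finite self-similar set. -/
structure PCFSet (X : Type*) [MetricSpace X] (s : ℕ) extends SelfSimilarSet X s where
  connected : IsConnected K
  finite_postCriticalSet : toSelfSimilarSet.postCriticalSet.Finite

/-- A discrete Laplacian on a finite set: a symmetric non-positive definite matrix whose kernel
consists of the constants and whose off-diagonal entries are non-negative. -/
structure IsDiscreteLaplacian {V : Type*} [Fintype V] (H : Matrix V V ℝ) : Prop where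
  symm : H.IsSymm
  nonpos : ∀ u : V → ℝ, u ⬝ᵥ (H *ᵥ u) ≤ 0
  ker : ∀ u : V → ℝ, H *ᵥ u = 0 ↔ ∃ c : ℝ, u = fun _ => c
  offDiag : ∀ p q, p ≠ q → 0 ≤ H p q

namespace PCFSet

variable {X : Type*} [MetricSpace X] {s : ℕ} (S : PCFSet X s)

instance fintypeV0 : Fintype S.V0 := (S.finite_postCriticalSet.image S.coding).fintype

/-- `(u ∘ F_w)|_{V₀}`. -/
def cellValues (u : S.K → ℝ) {m : ℕ} (w : Fin m → Fin s) : S.V0 → ℝ :=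
  fun q => u (S.wordMap w q)

/-- The energy `𝓔_m(u) = ∑_{|w| = m} r_w⁻¹ 𝓔₀(u ∘ F_w)` of level `m`, where
`𝓔₀(v) = - vᵗ H₀ v`. It depends only on `u|_{V_m}`. -/
def levelEnergy (H₀ : Matrix S.V0 S.V0 ℝ) (r : Fin s → ℝ) (m : ℕ) (u : S.K → ℝ) : ℝ :=
  ∑ w : Fin m → Fin s, (∏ k, r (w k))⁻¹ * -(S.cellValues u w ⬝ᵥ (H₀ *ᵥ S.cellValues u w))

/-- A regular harmonic structure `(H₀, r)`: the least value of `𝓔₁` among the functions with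
prescribed values `v` on `V₀` is `𝓔₀(v)`, and all `r i` lie in `(0, 1)`. (Since `𝓔₁(u)` depends
only on `u|_{V₁}`, it does not matter that `u` is given on all of `K`.) -/
structure RegularHarmonicStructure where
  H₀ : Matrix S.V0 S.V0 ℝ
  isLaplacian : IsDiscreteLaplacian H₀
  r : Fin s → ℝ
  r_pos : ∀ i, 0 < r i
  r_lt_one : ∀ i, r i < 1
  harmonic : ∀ v : S.V0 → ℝ,
    IsLeast {e : ℝ | ∃ u : S.K → ℝ, (∀ p : S.V0, u p = v p) ∧ e = S.levelEnergy H₀ r 1 u}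
      (-(v ⬝ᵥ (H₀ *ᵥ v)))

/-- `μ` is a self-similar probability measure with weights `ν`:
`μ = ∑ i, ν i · μ ∘ (F i)⁻¹`. -/
structure IsSelfSimilarMeasure [MeasurableSpace X] (ν : Fin s → ℝ) (μ : Measure S.K) : Prop where
  weight_pos : ∀ i, 0 < ν i
  weight_lt_one : ∀ i, ν i < 1
  weight_sum : ∑ i, ν i = 1
  isProbability : IsProbabilityMeasure μ
  selfSimilar : μ = ∑ i, ENNReal.ofReal (ν i) • μ.map (S.map i)

namespace RegularHarmonicStructure

variable {S} (D : S.RegularHarmonicStructure)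

/-- The energy `𝓔(u) = lim_m 𝓔_m(u) ∈ [0, ∞]`; the sequence is non-negative and non-decreasing,
so the limit is the supremum. -/
def energy (u : C(S.K, ℝ)) : ℝ≥0∞ :=
  ⨆ m : ℕ, ENNReal.ofReal (S.levelEnergy D.H₀ D.r m u)

/-- The continuous functions of finite energy. -/
def finiteEnergy : Set C(S.K, ℝ) := {u | D.energy u < ⊤}

/-- The functions among which `ψ_{m,p}` minimizes the energy. -/
def splineClass (m : ℕ) (p : S.K) : Set C(S.K, ℝ) :=
  {u | u ∈ D.finiteEnergy ∧ u p = 1 ∧ ∀ q ∈ S.V m, q ≠ p → u q = 0}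

/-- `ψ` is the function `ψ_{m,p}`: it has the least energy among the functions of finite energy
with value `1` at `p` and `0` on `V_m \ {p}`. -/
def IsSpline (m : ℕ) (p : S.K) (ψ : C(S.K, ℝ)) : Prop :=
  ψ ∈ D.splineClass m p ∧ ∀ u ∈ D.splineClass m p, D.energy ψ ≤ D.energy u

open Classical in
/-- `(H_m u)(p)` for `H_m = ∑_{|w| = m} r_w⁻¹ R_wᵗ H₀ R_w` with `R_w u = (u ∘ F_w)|_{V₀}`;
thus `(R_wᵗ g)(p)` is the sum of `g q` over the `q ∈ V₀` with `F_w q = p`. -/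
def levelLaplacian (m : ℕ) (u : S.K → ℝ) (p : S.K) : ℝ :=
  ∑ w : Fin m → Fin s, (∏ k, D.r (w k))⁻¹ *
    ∑ q : S.V0, if S.wordMap w q = p then (D.H₀ *ᵥ S.cellValues u w) q else 0

/-- `u` is in the domain of the `μ`-Laplacian and `Δ_μ u = f`: the quantity
`μ_{m,p}⁻¹ (H_m u)(p) - f(p)`, with `μ_{m,p} = ∫ ψ_{m,p} dμ`, tends to `0` as `m → ∞`,
uniformly in `p ∈ V_m \ V₀`. -/
def HasLaplacian [MeasurableSpace X] (μ : Measure S.K) (u f : C(S.K, ℝ)) : Prop :=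
  ∀ ε : ℝ, 0 < ε → ∃ M : ℕ, ∀ m, M ≤ m → ∀ p ∈ S.V m \ S.V0,
    ∃ ψ : C(S.K, ℝ), D.IsSpline m p ψ ∧
      |(∫ x, ψ x ∂μ)⁻¹ * D.levelLaplacian m u p - f p| ≤ ε

/-- `u` is a `lam`-eigenfunction of `-Δ_μ`: a non-zero function in the domain of `Δ_μ` with
`-Δ_μ u = lam · u` on `K \ V₀`; no boundary condition is imposed. -/
def IsEigenfunction [MeasurableSpace X] (μ : Measure S.K) (lam : ℝ) (u : C(S.K, ℝ)) : Prop :=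
  u ≠ 0 ∧ ∃ f : C(S.K, ℝ), D.HasLaplacian μ u f ∧ ∀ x, x ∉ S.V0 → -(f x) = lam * u x

/-- The exponent `γ_i = √(r_i μ_i)`. -/
def gamma (ν : Fin s → ℝ) (i : Fin s) : ℝ := √(D.r i * ν i)

/-- `d` is the spectral exponent of `-Δ_μ`: the (unique) real number with `∑ i, γ_i ^ d = 1`. -/
def IsSpectralExponent (ν : Fin s → ℝ) (d : ℝ) : Prop := ∑ i, D.gamma ν i ^ d = 1

end RegularHarmonicStructure

/-- `A` is a connected component of the level set `u⁻¹(c)` and does not meet the boundary. -/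
def IsInteriorLevelComponent (u : C(S.K, ℝ)) (A : Set S.K) (c : ℝ) : Prop :=
  (∃ x ∈ u ⁻¹' {c}, A = connectedComponentIn (u ⁻¹' {c}) x) ∧ A ∩ S.V0 = ∅

/-- `u` has a local maximum at `A` with value `c`. -/
def HasLocalMaxAt (u : C(S.K, ℝ)) (A : Set S.K) (c : ℝ) : Prop :=
  S.IsInteriorLevelComponent u A c ∧ ∃ δ > 0, ∀ p ∈ Metric.thickening δ A, u p ≤ c

/-- `u` has a local minimum at `A` with value `c`. -/
def HasLocalMinAt (u : C(S.K, ℝ)) (A : Set S.K) (c : ℝ) : Prop :=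
  S.IsInteriorLevelComponent u A c ∧ ∃ δ > 0, ∀ p ∈ Metric.thickening δ A, c ≤ u p

/-- `A` is a local extreme set of `u`. -/
def IsExtremeSet (u : C(S.K, ℝ)) (A : Set S.K) : Prop :=
  ∃ c : ℝ, S.HasLocalMaxAt u A c ∨ S.HasLocalMinAt u A c

/-- The number `N(u) ∈ {0, 1, …, ∞}` of extreme sets of `u`. -/
def extremeCount (u : C(S.K, ℝ)) : ℕ∞ := {A : Set S.K | S.IsExtremeSet u A}.encard

namespace RegularHarmonicStructure

variable {S} (D : S.RegularHarmonicStructure)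

/-- The extremum counting function `N(x)`: the supremum of `N(u)` over all `lam`-eigenfunctions
`u` with `0 ≤ lam ≤ x`. -/
def extremumCountingFunction [MeasurableSpace X] (μ : Measure S.K) (x : ℝ) : ℕ∞ :=
  ⨆ (lam : ℝ) (u : C(S.K, ℝ)) (_ : 0 ≤ lam ∧ lam ≤ x ∧ D.IsEigenfunction μ lam u),
    S.extremeCount u

/-- Condition (A): for some `lam₀ > 0`, every `lam`-eigenfunction with `0 ≤ lam < lam₀` has at
most one extreme set. -/
def ConditionA [MeasurableSpace X] (μ : Measure S.K) : Prop :=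
  ∃ lam₀ : ℝ, 0 < lam₀ ∧ ∀ (lam : ℝ) (u : C(S.K, ℝ)), 0 ≤ lam → lam < lam₀ →
    D.IsEigenfunction μ lam u → S.extremeCount u ≤ 1

end RegularHarmonicStructure

end PCFSet

end

/-!
The bound follows from the self-similarity of the `μ`-Laplacian. If `u` is a `lam`-eigenfunction,
then `u ∘ F i` is zero or a `γ i ^ 2 * lam`-eigenfunction, where `γ i ^ 2 = r i * ν i`
(`IsEigenfunction.comp_cellMap`). The extreme sets of `u` that avoid the finite set `V₁` lie in
single cells `F i K` and are images of extreme sets of `u ∘ F i`; those that meet `V₁` are at most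
as many as its points, because extreme sets are pairwise disjoint (`extremeCount_le`). Hence
`N x ≤ ∑ i, N (γ i ^ 2 * x) + #V₁`, while `N ≤ 1` near `0` by condition (A). As `∑ i, γ i ^ d = 1`,
this renewal inequality gives `N x ≤ A * x ^ (d / 2)` for large `x`
(`exists_forall_le_mul_rpow_of_le_sum`).

The scaling of the pointwise Laplacian (`HasLaplacian.comp_cellMap`) compares the splines of two
consecutive levels: for an interior vertex `p` of level `m`, the spline `ψ` at `F i p` of level
`m + 1` restricts to the spline at `p` on the cell `F i K`, and vanishes on the other cells, so that
`∫ ψ = ν i * ∫ ψ ∘ F i`. Both facts hold because a function vanishing on `V₀` can be transplanted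
to a cell and extended by zero, which multiplies its energy by `(r i)⁻¹`, and because functions of
zero energy are constant. All of this rests on the fact that distinct cells meet only at images
of boundary points (`mem_V0_of_map_eq_map`).
-/

namespace SelfSimilarSet

variable {X : Type*} [MetricSpace X] {s : ℕ} (S : SelfSimilarSet X s)

/-! ### Codings and cells -/

instance compactSpace_K : CompactSpace S.K := isCompact_iff_compactSpace.1 S.isCompact

instance nonempty_K : Nonempty S.K := S.nonempty.to_subtype

theorem map_injective (i : Fin s) : Function.Injective (S.map i) := fun x y h =>
  Subtype.ext (S.injOn i x.2 y.2 (congrArg Subtype.val h))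

theorem exists_map_eq (x : S.K) : ∃ i y, S.map i y = x := by
  have hx : (x : X) ∈ ⋃ i, S.F i '' S.K := by
    rw [← S.eq_iUnion]
    exact x.2
  obtain ⟨i, y, hy, h⟩ := mem_iUnion.1 hx
  exact ⟨i, ⟨y, hy⟩, Subtype.ext h⟩

theorem isClosedEmbedding_map (i : Fin s) : IsClosedEmbedding (S.map i) :=
  (S.continuous_map i).isClosedEmbedding (S.map_injective i)

theorem isClosed_range_map (i : Fin s) : IsClosed (range (S.map i)) :=
  (S.isClosedEmbedding_map i).isClosed_range

theorem coding_eq_of_forall_mem {ω : ℕ → Fin s} {x : S.K}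
    (h : ∀ m : ℕ, x ∈ range (S.wordMap fun k : Fin m => ω k)) : S.coding ω = x :=
  ((S.existsUnique_coding ω).choose_spec.2 x h).symm

theorem coding_mem (ω : ℕ → Fin s) (m : ℕ) :
    S.coding ω ∈ range (S.wordMap fun k : Fin m => ω k) :=
  (S.existsUnique_coding ω).choose_spec.1 m

theorem map_coding_shift (ω : ℕ → Fin s) :
    S.map (ω 0) (S.coding fun n => ω (n + 1)) = S.coding ω := by
  refine (S.coding_eq_of_forall_mem fun m => ?_).symm
  cases m with
  | zero => exact ⟨_, rfl⟩
  | succ m =>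
    obtain ⟨y, hy⟩ := S.coding_mem (fun n => ω (n + 1)) m
    exact ⟨y, congrArg (S.map (ω 0)) hy⟩

theorem wordMap_coding_shift (ω : ℕ → Fin s) (m : ℕ) :
    S.wordMap (fun k : Fin m => ω k) (S.coding fun n => ω (n + m)) = S.coding ω := by
  induction m with
  | zero => rfl
  | succ m ih =>
    rw [S.wordMap_truncate_succ, Function.comp_apply, ← ih,
      ← S.map_coding_shift fun n => ω (n + m)]
    simp only [zero_add, Nat.add_right_comm _ 1 m, ← Nat.add_assoc]

/-- The infinite word `i ω`. -/
def consWord (i : Fin s) (ω : ℕ → Fin s) : ℕ → Fin s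
  | 0 => i
  | n + 1 => ω n

theorem coding_consWord (i : Fin s) (ω : ℕ → Fin s) :
    S.coding (consWord i ω) = S.map i (S.coding ω) :=
  (S.map_coding_shift (consWord i ω)).symm

theorem coding_surjective : Function.Surjective S.coding := by
  choose d p hp using S.exists_map_eq
  intro x
  have key : ∀ (m : ℕ) (x : S.K), S.wordMap (fun k : Fin m => d (p^[k] x)) (p^[m] x) = x := by
    intro m
    induction m with
    | zero => intro x; rfl
    | succ m ih =>
      intro x
      exact (congrArg (S.map (d x)) (ih (p x))).trans (hp x)
  exact ⟨fun n => d (p^[n] x), S.coding_eq_of_forall_mem fun m => ⟨_, key m x⟩⟩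

theorem shift_mem_postCriticalSet {τ : ℕ → Fin s} (h : τ ∈ S.postCriticalSet) :
    (fun n => τ (n + 1)) ∈ S.postCriticalSet := by
  obtain ⟨m, hm, ω, hω, rfl⟩ := h
  exact ⟨m + 1, by omega, ω, hω, by
    funext n
    exact congrArg ω (by omega)⟩

/-- Every coding of a point of `V₀` is post-critical: replacing the tail of a critical word by
another coding of the same point leaves the point coded by the whole word unchanged. -/
theorem mem_postCriticalSet_of_coding_eq {τ τ' : ℕ → Fin s} (h : τ ∈ S.postCriticalSet)
    (e : S.coding τ' = S.coding τ) : τ' ∈ S.postCriticalSet := by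
  obtain ⟨m, hm, ω, hω, rfl⟩ := h
  let ω' : ℕ → Fin s := fun n => if n < m then ω n else τ' (n - m)
  have h1 : (fun n => ω' (n + m)) = τ' := by
    funext n
    simp [ω']
  have h2 : (fun k : Fin m => ω' k) = fun k : Fin m => ω k := by
    funext k
    simp [ω']
  have h3 : S.coding ω' = S.coding ω := by
    rw [← S.wordMap_coding_shift ω' m, h1, h2, e, S.wordMap_coding_shift]
  refine ⟨m, hm, ω', ?_, h1.symm⟩
  obtain ⟨i, j, hij, hc⟩ := hω
  exact ⟨i, j, hij, by rwa [h3]⟩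

theorem mem_V0_of_map_mem_V0 {i : Fin s} {x : S.K} (h : S.map i x ∈ S.V0) : x ∈ S.V0 := by
  obtain ⟨η, rfl⟩ := S.coding_surjective x
  obtain ⟨τ, hτ, e⟩ := h
  rw [← S.coding_consWord] at e
  exact ⟨η, S.shift_mem_postCriticalSet (S.mem_postCriticalSet_of_coding_eq hτ e.symm), rfl⟩

/-- Distinct cells of level one meet only at images of boundary points. -/
theorem mem_V0_of_map_eq_map {i j : Fin s} (hij : i ≠ j) {x y : S.K}
    (h : S.map i x = S.map j y) : x ∈ S.V0 := by
  obtain ⟨η, rfl⟩ := S.coding_surjective x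
  exact ⟨η, ⟨1, le_rfl, consWord i η,
    ⟨i, j, hij, by rw [S.coding_consWord]; exact ⟨⟨_, rfl⟩, ⟨y, h.symm⟩⟩⟩, rfl⟩, rfl⟩

theorem mem_V_zero {x : S.K} : x ∈ S.V 0 ↔ x ∈ S.V0 := by
  simp [V, wordMap]

theorem mem_V_succ {m : ℕ} {x : S.K} : x ∈ S.V (m + 1) ↔ ∃ i, ∃ y ∈ S.V m, S.map i y = x := by
  simp only [V, mem_iUnion, mem_image]
  constructor
  · rintro ⟨w, q, hq, rfl⟩
    exact ⟨w 0, S.wordMap (Fin.tail w) q, ⟨_, q, hq, rfl⟩, rfl⟩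
  · rintro ⟨i, _, ⟨w, q, hq, rfl⟩, rfl⟩
    exact ⟨Fin.cons i w, q, hq, rfl⟩

theorem V0_subset_V (m : ℕ) : S.V0 ⊆ S.V m := by
  induction m with
  | zero => exact fun x hx => S.mem_V_zero.2 hx
  | succ m ih =>
    rintro _ ⟨τ, hτ, rfl⟩
    exact S.mem_V_succ.2 ⟨τ 0, _, ih ⟨_, S.shift_mem_postCriticalSet hτ, rfl⟩,
      S.map_coding_shift τ⟩

/-- The vertices are dense, because the cells shrink. -/
theorem eq_of_eqOn_V {u v : C(S.K, ℝ)} (h0 : S.V0.Nonempty) (h : ∀ m, EqOn u v (S.V m)) :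
    u = v := by
  obtain ⟨c, hc0, hc1, hc⟩ := S.exists_ratio
  have approx : ∀ (m : ℕ) (x : S.K), ∃ y ∈ S.V m,
      dist x y ≤ c ^ m * Metric.diam (univ : Set S.K) := by
    intro m
    induction m with
    | zero =>
      intro x
      obtain ⟨q, hq⟩ := h0
      refine ⟨q, S.mem_V_zero.2 hq, ?_⟩
      rw [pow_zero, one_mul]
      exact Metric.dist_le_diam_of_mem isCompact_univ.isBounded (mem_univ _) (mem_univ _)
    | succ m ih =>
      intro x
      obtain ⟨i, x', rfl⟩ := S.exists_map_eq x
      obtain ⟨y, hy, hd⟩ := ih x'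
      refine ⟨S.map i y, S.mem_V_succ.2 ⟨i, y, hy, rfl⟩, (hc i _ _).trans ?_⟩
      rw [pow_succ', mul_assoc]
      exact mul_le_mul_of_nonneg_left hd hc0
  have hlim : Tendsto (fun m : ℕ => c ^ m * Metric.diam (univ : Set S.K)) atTop (𝓝 0) := by
    simpa using (tendsto_pow_atTop_nhds_zero_of_lt_one hc0 hc1).mul_const _
  ext x
  choose y hy hd using fun m => approx m x
  have hy' : Tendsto y atTop (𝓝 x) := by
    rw [tendsto_iff_dist_tendsto_zero]
    exact squeeze_zero (fun _ => dist_nonneg) (fun m => by rw [dist_comm]; exact hd m) hlim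
  refine tendsto_nhds_unique ((u.continuous.tendsto x).comp hy') ?_
  exact ((v.continuous.tendsto x).comp hy').congr fun m => (h m (hy m)).symm

/-- The map `F i`, as a continuous self-map of `K`. -/
def cellMap (i : Fin s) : C(S.K, S.K) := ⟨S.map i, S.continuous_map i⟩

@[simp]
theorem cellMap_apply (i : Fin s) (x : S.K) : S.cellMap i x = S.map i x := rfl

/-- A continuous function vanishing on `V₀`, transplanted to the cell `F i K` and extended by `0`,
is continuous: `K` carries the quotient topology of the disjoint union of its cells. -/
theorem exists_comp_cellMap_eq_of_eq_zero {φ : C(S.K, ℝ)} (hφ : ∀ q ∈ S.V0, φ q = 0)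
    (i : Fin s) :
    ∃ g : C(S.K, ℝ), g.comp (S.cellMap i) = φ ∧ ∀ j, j ≠ i → g.comp (S.cellMap j) = 0 := by
  classical
  let g : S.K → ℝ := fun x => if h : ∃ y, S.map i y = x then φ h.choose else 0
  have gi : ∀ y, g (S.map i y) = φ y := fun y => by
    have h : ∃ z, S.map i z = S.map i y := ⟨y, rfl⟩
    simp only [g, dif_pos h]
    rw [S.map_injective i h.choose_spec]
  have gj : ∀ j, j ≠ i → ∀ y, g (S.map j y) = 0 := fun j hj y => by
    by_cases h : ∃ z, S.map i z = S.map j y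
    · simp only [g, dif_pos h]
      exact hφ _ (S.mem_V0_of_map_eq_map hj.symm h.choose_spec)
    · simp only [g, dif_neg h]
  have hq : IsQuotientMap (fun x : Σ _ : Fin s, S.K => S.map x.1 x.2) := by
    have hcont : Continuous (fun x : Σ _ : Fin s, S.K => S.map x.1 x.2) :=
      continuous_sigma fun i => S.continuous_map i
    refine hcont.isClosedMap.isQuotientMap hcont fun x => ?_
    obtain ⟨j, y, h⟩ := S.exists_map_eq x
    exact ⟨⟨j, y⟩, h⟩
  have hg : Continuous g := by
    rw [hq.continuous_iff, continuous_sigma_iff]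
    intro j
    by_cases hj : j = i
    · subst hj
      exact φ.continuous.congr fun y => (gi y).symm
    · exact continuous_const.congr fun y => (gj j hj y).symm
  exact ⟨⟨g, hg⟩, ContinuousMap.ext gi, fun j hj => ContinuousMap.ext (gj j hj)⟩

end SelfSimilarSet

namespace PCFSet

variable {X : Type*} [MetricSpace X] {s : ℕ} (S : PCFSet X s)

instance preconnectedSpace_K : PreconnectedSpace S.K :=
  Subtype.preconnectedSpace S.connected.isPreconnected

/-- The cells of level one are chained together: a property of the index that is passed on
between cells with a common point holds for all indices or for none. -/
theorem forall_of_forall_meet {P : Fin s → Prop} (i₀ : Fin s) (h₀ : P i₀)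
    (h : ∀ i j x y, P i → S.map i x = S.map j y → P j) (j : Fin s) : P j := by
  by_contra hj
  let A : Set S.K := ⋃ i ∈ {i | P i}, range (S.map i)
  let B : Set S.K := ⋃ i ∈ {i | ¬ P i}, range (S.map i)
  have hA : IsClosed A := (toFinite _).isClosed_biUnion fun i _ => S.isClosed_range_map i
  have hB : IsClosed B := (toFinite _).isClosed_biUnion fun i _ => S.isClosed_range_map i
  have x₀ : S.K := Classical.arbitrary S.K
  have hcov : (univ : Set S.K) ⊆ A ∪ B := fun x _ => by
    obtain ⟨i, y, rfl⟩ := S.exists_map_eq x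
    by_cases hi : P i
    · exact Or.inl (mem_biUnion (show i ∈ {i | P i} from hi) ⟨y, rfl⟩)
    · exact Or.inr (mem_biUnion (show i ∈ {i | ¬ P i} from hi) ⟨y, rfl⟩)
  obtain ⟨x, -, hxA, hxB⟩ := isPreconnected_closed_iff.1 isPreconnected_univ A B hA hB hcov
    ⟨S.map i₀ x₀, mem_univ _, mem_biUnion (show i₀ ∈ {i | P i} from h₀) ⟨x₀, rfl⟩⟩
    ⟨S.map j x₀, mem_univ _, mem_biUnion (show j ∈ {i | ¬ P i} from hj) ⟨x₀, rfl⟩⟩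
  obtain ⟨i, hi, y, hy⟩ := mem_iUnion₂.1 hxA
  obtain ⟨k, hk, z, hz⟩ := mem_iUnion₂.1 hxB
  exact hk (h i k y z hi (hy.trans hz.symm))

theorem V0_nonempty : S.V0.Nonempty := by
  by_contra hne
  have hs := S.two_le
  let i₀ : Fin s := ⟨0, by omega⟩
  have := S.forall_of_forall_meet (P := fun i => i = i₀) i₀ rfl (fun i j x y hi hxy => by
    by_contra hj
    exact hne ⟨x, S.mem_V0_of_map_eq_map (fun e : i = j => hj (e.symm.trans hi)) hxy⟩) ⟨1, by omega⟩
  simp [i₀] at this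

end PCFSet

namespace PCFSet

variable {X : Type*} [MetricSpace X] {s : ℕ} (S : PCFSet X s)

/-! ### Self-similarity of the energy -/

theorem levelEnergy_succ (H₀ : Matrix S.V0 S.V0 ℝ) (r : Fin s → ℝ) (m : ℕ) (u : S.K → ℝ) :
    S.levelEnergy H₀ r (m + 1) u = ∑ i, (r i)⁻¹ * S.levelEnergy H₀ r m (u ∘ S.map i) := by
  simp only [levelEnergy, Finset.mul_sum]
  rw [← (Fin.consEquiv fun _ : Fin (m + 1) => Fin s).sum_comp, Fintype.sum_prod_type]
  refine Finset.sum_congr rfl fun i _ => Finset.sum_congr rfl fun w _ => ?_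
  have e : S.cellValues u (Fin.consEquiv (fun _ : Fin (m + 1) => Fin s) (i, w)) =
      S.cellValues (u ∘ S.map i) w := rfl
  rw [e, Fin.prod_univ_succ, mul_inv, mul_assoc]
  rfl

theorem levelEnergy_zero (H₀ : Matrix S.V0 S.V0 ℝ) (r : Fin s → ℝ) (u : S.K → ℝ) :
    S.levelEnergy H₀ r 0 u = -((fun q : S.V0 => u q) ⬝ᵥ (H₀ *ᵥ fun q : S.V0 => u q)) := by
  simp [levelEnergy]
  rfl

namespace RegularHarmonicStructure

variable {S} (D : S.RegularHarmonicStructure)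

theorem levelEnergy_nonneg (m : ℕ) (u : S.K → ℝ) : 0 ≤ S.levelEnergy D.H₀ D.r m u :=
  Finset.sum_nonneg fun _ _ => mul_nonneg
    (inv_nonneg.2 (Finset.prod_nonneg fun _ _ => (D.r_pos _).le))
    (neg_nonneg.2 (D.isLaplacian.nonpos _))

theorem levelEnergy_le_succ (m : ℕ) (u : S.K → ℝ) :
    S.levelEnergy D.H₀ D.r m u ≤ S.levelEnergy D.H₀ D.r (m + 1) u := by
  induction m generalizing u with
  | zero =>
    rw [S.levelEnergy_zero]
    exact (D.harmonic fun q => u q).2 ⟨u, fun _ => rfl, rfl⟩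
  | succ m ih =>
    rw [S.levelEnergy_succ, S.levelEnergy_succ _ _ (m + 1)]
    exact Finset.sum_le_sum fun i _ =>
      mul_le_mul_of_nonneg_left (ih _) (inv_nonneg.2 (D.r_pos i).le)

theorem energy_eq_sum (u : C(S.K, ℝ)) :
    D.energy u = ∑ i, ENNReal.ofReal (D.r i)⁻¹ * D.energy (u.comp (S.cellMap i)) := by
  have hmono : ∀ v : C(S.K, ℝ),
      Monotone fun m => ENNReal.ofReal (S.levelEnergy D.H₀ D.r m v) := fun v =>
    monotone_nat_of_le_succ fun m => ENNReal.ofReal_le_ofReal (D.levelEnergy_le_succ m v)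
  have hr : ∀ i, 0 ≤ (D.r i)⁻¹ := fun i => inv_nonneg.2 (D.r_pos i).le
  simp only [energy, ENNReal.mul_iSup]
  rw [ENNReal.finsetSum_iSup_of_monotone (f := fun i m => ENNReal.ofReal (D.r i)⁻¹ *
      ENNReal.ofReal (S.levelEnergy D.H₀ D.r m (u.comp (S.cellMap i))))
      fun i _ _ h => mul_le_mul_right (hmono _ h) _,
    ← (hmono u).iSup_nat_add 1]
  refine iSup_congr fun m => ?_
  rw [S.levelEnergy_succ, ENNReal.ofReal_sum_of_nonneg fun i _ =>
    mul_nonneg (hr i) (D.levelEnergy_nonneg _ _)]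
  exact Finset.sum_congr rfl fun i _ => ENNReal.ofReal_mul (hr i)

theorem ofReal_inv_r_ne_zero (i : Fin s) : ENNReal.ofReal (D.r i)⁻¹ ≠ 0 :=
  (ENNReal.ofReal_pos.2 (inv_pos.2 (D.r_pos i))).ne'

@[simp]
theorem energy_zero : D.energy 0 = 0 := by
  have : ∀ m, S.levelEnergy D.H₀ D.r m (0 : S.K → ℝ) = 0 := fun m =>
    Finset.sum_eq_zero fun w _ => by
      have : S.cellValues (0 : S.K → ℝ) w = 0 := rfl
      simp [this]
  simp [energy, this]

theorem energy_comp_cellMap_eq_zero {u : C(S.K, ℝ)} (h : D.energy u = 0) (i : Fin s) :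
    D.energy (u.comp (S.cellMap i)) = 0 := by
  rw [D.energy_eq_sum, Finset.sum_eq_zero_iff] at h
  exact (mul_eq_zero.1 (h i (Finset.mem_univ i))).resolve_left (D.ofReal_inv_r_ne_zero i)

theorem comp_cellMap_mem_finiteEnergy {u : C(S.K, ℝ)} (h : u ∈ D.finiteEnergy) (i : Fin s) :
    u.comp (S.cellMap i) ∈ D.finiteEnergy := by
  have h' : D.energy u < ⊤ := h
  rw [D.energy_eq_sum, ENNReal.sum_lt_top] at h'
  exact ENNReal.lt_top_of_mul_ne_top_right (h' i (Finset.mem_univ i)).ne (D.ofReal_inv_r_ne_zero i)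

theorem exists_eqOn_V0_const {u : C(S.K, ℝ)} (h : D.energy u = 0) :
    ∃ c, ∀ x ∈ S.V0, u x = c := by
  let v : S.V0 → ℝ := fun q => u q
  have h0 : v ⬝ᵥ (D.H₀ *ᵥ v) = 0 := by
    have h1 : ENNReal.ofReal (S.levelEnergy D.H₀ D.r 0 u) ≤ D.energy u :=
      le_iSup (fun m => ENNReal.ofReal (S.levelEnergy D.H₀ D.r m u)) 0
    rw [h, nonpos_iff_eq_zero, ENNReal.ofReal_eq_zero, S.levelEnergy_zero] at h1
    exact le_antisymm (D.isLaplacian.nonpos v) (by linarith)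
  have hpos : (-D.H₀).PosSemidef := by
    refine .of_dotProduct_mulVec_nonneg ?_ fun x => ?_
    · have hs : D.H₀ᵀ = D.H₀ := D.isLaplacian.symm
      rw [Matrix.IsHermitian, Matrix.conjTranspose_eq_transpose_of_trivial, Matrix.transpose_neg,
        hs]
    · rw [star_trivial, Matrix.neg_mulVec, dotProduct_neg]
      exact neg_nonneg.2 (D.isLaplacian.nonpos x)
  have h2 : D.H₀ *ᵥ v = 0 := by
    have := (hpos.dotProduct_mulVec_zero_iff v).1
      (by rw [star_trivial, Matrix.neg_mulVec, dotProduct_neg, h0, neg_zero])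
    rwa [Matrix.neg_mulVec, neg_eq_zero] at this
  obtain ⟨c, hc⟩ := (D.isLaplacian.ker v).1 h2
  exact ⟨c, fun x hx => congrFun hc ⟨x, hx⟩⟩

/-- A function of zero energy is constant on the vertices: it is constant on the boundary of each
cell, and the cells are chained together. -/
theorem exists_eqOn_V_const (m : ℕ) {u : C(S.K, ℝ)} (h : D.energy u = 0) :
    ∃ c, ∀ x ∈ S.V m, u x = c := by
  induction m generalizing u with
  | zero =>
    obtain ⟨c, hc⟩ := D.exists_eqOn_V0_const h
    exact ⟨c, fun x hx => hc x (S.mem_V_zero.1 hx)⟩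
  | succ m ih =>
    choose c hc using fun i => ih (D.energy_comp_cellMap_eq_zero h i)
    have hs := S.two_le
    let i₀ : Fin s := ⟨0, by omega⟩
    have hall := S.forall_of_forall_meet (P := fun i => c i = c i₀) i₀ rfl
      fun i j x y hi hxy => by
        by_cases hij : i = j
        · exact hij ▸ hi
        · rw [← hi, ← hc i x (S.V0_subset_V m (S.mem_V0_of_map_eq_map hij hxy)),
            ← hc j y (S.V0_subset_V m (S.mem_V0_of_map_eq_map (Ne.symm hij) hxy.symm))]
          exact (congrArg u hxy).symm
    refine ⟨c i₀, fun x hx => ?_⟩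
    obtain ⟨i, y, hy, rfl⟩ := S.mem_V_succ.1 hx
    exact (hc i y hy).trans (hall i)

theorem eq_zero_of_energy_eq_zero {u : C(S.K, ℝ)} (h : D.energy u = 0)
    (h0 : ∀ q ∈ S.V0, u q = 0) : u = 0 := by
  refine S.eq_of_eqOn_V S.V0_nonempty fun m x hx => ?_
  obtain ⟨c, hc⟩ := D.exists_eqOn_V_const m h
  obtain ⟨q, hq⟩ := S.V0_nonempty
  rw [hc x hx, ← hc q (S.V0_subset_V m hq), h0 q hq]
  rfl

/-! ### Restriction of the Laplacian to a cell -/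

theorem comp_cellMap_mem_splineClass {m : ℕ} {i : Fin s} {p : S.K} {u : C(S.K, ℝ)}
    (h : u ∈ D.splineClass (m + 1) (S.map i p)) : u.comp (S.cellMap i) ∈ D.splineClass m p :=
  ⟨D.comp_cellMap_mem_finiteEnergy h.1 i, h.2.1, fun q hq hne =>
    h.2.2 _ (S.mem_V_succ.2 ⟨i, q, hq, rfl⟩) fun e => hne (S.map_injective i e)⟩

/-- For an interior vertex `p`, a competitor for `ψ_{m,p}`, transplanted to `F i K` and extended
by zero, is a competitor for `ψ_{m+1, F i p}`, with `(r i)⁻¹` times the energy. -/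
theorem exists_mem_splineClass_succ {m : ℕ} (i : Fin s) {p : S.K} (hp : p ∉ S.V0)
    {φ : C(S.K, ℝ)} (h : φ ∈ D.splineClass m p) :
    ∃ g ∈ D.splineClass (m + 1) (S.map i p),
      D.energy g = ENNReal.ofReal (D.r i)⁻¹ * D.energy φ := by
  obtain ⟨g, hgi, hgj⟩ := S.exists_comp_cellMap_eq_of_eq_zero
    (fun q hq => h.2.2 q (S.V0_subset_V m hq) (ne_of_mem_of_not_mem hq hp)) i
  have hE : D.energy g = ENNReal.ofReal (D.r i)⁻¹ * D.energy φ := by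
    rw [D.energy_eq_sum, Finset.sum_eq_single i, hgi]
    · intro j _ hj
      rw [hgj j hj, energy_zero, mul_zero]
    · exact fun hi => absurd (Finset.mem_univ i) hi
  refine ⟨g, ⟨?_, ?_, fun q hq hne => ?_⟩, hE⟩
  · show D.energy g < ⊤
    rw [hE]
    exact ENNReal.mul_lt_top ENNReal.ofReal_lt_top h.1
  · exact (DFunLike.congr_fun hgi p).trans h.2.1
  · obtain ⟨j, y, hy, rfl⟩ := S.mem_V_succ.1 hq
    by_cases hj : j = i
    · subst hj
      exact (DFunLike.congr_fun hgi y).trans (h.2.2 y hy fun e => hne (e ▸ rfl))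
    · exact DFunLike.congr_fun (hgj j hj) y

theorem IsSpline.comp_cellMap {m : ℕ} {i : Fin s} {p : S.K} (hp : p ∉ S.V0) {ψ : C(S.K, ℝ)}
    (h : D.IsSpline (m + 1) (S.map i p) ψ) : D.IsSpline m p (ψ.comp (S.cellMap i)) := by
  refine ⟨D.comp_cellMap_mem_splineClass h.1, fun φ hφ => ?_⟩
  obtain ⟨g, hg, hE⟩ := D.exists_mem_splineClass_succ i hp hφ
  have h1 := h.2 g hg
  rw [hE] at h1
  have h2 : ENNReal.ofReal (D.r i)⁻¹ * D.energy (ψ.comp (S.cellMap i)) ≤ D.energy ψ := by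
    rw [D.energy_eq_sum ψ]
    exact Finset.single_le_sum (f := fun j => ENNReal.ofReal (D.r j)⁻¹ *
      D.energy (ψ.comp (S.cellMap j))) (fun _ _ => zero_le) (Finset.mem_univ i)
  exact (ENNReal.mul_le_mul_iff_right (D.ofReal_inv_r_ne_zero i) ENNReal.ofReal_ne_top).1
    (h2.trans h1)

/-- The spline at a vertex interior to `F i K` vanishes on the other cells: erasing it there does
not increase the energy, so it has zero energy there. -/
theorem IsSpline.comp_cellMap_eq_zero {m : ℕ} {i j : Fin s} (hij : j ≠ i) {p : S.K}
    (hp : p ∉ S.V0) {ψ : C(S.K, ℝ)} (h : D.IsSpline (m + 1) (S.map i p) ψ) :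
    ψ.comp (S.cellMap j) = 0 := by
  refine D.eq_zero_of_energy_eq_zero ?_ fun q hq => ?_
  · obtain ⟨g, hg, hE⟩ := D.exists_mem_splineClass_succ i hp
      (D.comp_cellMap_mem_splineClass h.1)
    have h1 := h.2 g hg
    have hfin : ENNReal.ofReal (D.r i)⁻¹ * D.energy (ψ.comp (S.cellMap i)) ≠ ⊤ :=
      ENNReal.mul_ne_top ENNReal.ofReal_ne_top (D.comp_cellMap_mem_finiteEnergy h.1.1 i).ne
    rw [hE, D.energy_eq_sum ψ, ← Finset.add_sum_erase _ _ (Finset.mem_univ i)] at h1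
    have h2 : ∑ k ∈ Finset.univ.erase i, ENNReal.ofReal (D.r k)⁻¹ *
        D.energy (ψ.comp (S.cellMap k)) = 0 := by
      rw [← nonpos_iff_eq_zero]
      refine (ENNReal.add_le_add_iff_left hfin).1 (h1.trans ?_)
      rw [add_zero]
    rw [Finset.sum_eq_zero_iff] at h2
    exact (mul_eq_zero.1 (h2 j (Finset.mem_erase.2 ⟨hij, Finset.mem_univ j⟩))).resolve_left
      (D.ofReal_inv_r_ne_zero j)
  · exact h.1.2.2 _ (S.mem_V_succ.2 ⟨j, q, S.V0_subset_V m hq, rfl⟩) fun e =>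
      hp (S.mem_V0_of_map_eq_map (Ne.symm hij) e.symm)

theorem levelLaplacian_succ (m : ℕ) (u : S.K → ℝ) (i : Fin s) {p : S.K} (hp : p ∉ S.V0) :
    D.levelLaplacian (m + 1) u (S.map i p) =
      (D.r i)⁻¹ * D.levelLaplacian m (u ∘ S.map i) p := by
  classical
  simp only [levelLaplacian]
  rw [← (Fin.consEquiv fun _ : Fin (m + 1) => Fin s).sum_comp, Fintype.sum_prod_type,
    Finset.sum_eq_single i, Finset.mul_sum]
  · refine Finset.sum_congr rfl fun w _ => ?_
    have e : S.cellValues u (Fin.consEquiv (fun _ : Fin (m + 1) => Fin s) (i, w)) =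
        S.cellValues (u ∘ S.map i) w := rfl
    rw [e, Fin.prod_univ_succ, mul_inv, mul_assoc]
    refine congrArg₂ _ rfl (congrArg₂ _ rfl ?_)
    refine Finset.sum_congr rfl fun q _ => if_congr ?_ rfl rfl
    exact (S.map_injective i).eq_iff
  · intro j _ hj
    refine Finset.sum_eq_zero fun w _ => ?_
    rw [Finset.sum_eq_zero, mul_zero]
    intro q _
    refine if_neg fun e => ?_
    exact hp (S.mem_V0_of_map_eq_map (Ne.symm hj) (Eq.symm e))
  · exact fun hi => absurd (Finset.mem_univ i) hi

theorem integral_eq_sum [MeasurableSpace X] [BorelSpace X] {ν : Fin s → ℝ} {μ : Measure S.K}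
    (hμ : S.IsSelfSimilarMeasure ν μ) (u : C(S.K, ℝ)) :
    ∫ x, u x ∂μ = ∑ i, ν i * ∫ x, u (S.map i x) ∂μ := by
  have := hμ.isProbability
  have hmeas : ∀ i, Measurable (S.map i) := fun i => (S.continuous_map i).measurable
  have hint : ∀ ρ : Measure S.K, IsFiniteMeasure ρ → Integrable u ρ := fun ρ _ =>
    u.continuous.integrable_of_hasCompactSupport (HasCompactSupport.of_compactSpace _)
  conv_lhs => rw [hμ.selfSimilar]
  rw [integral_finsetSum_measure fun i _ =>
    (hint _ inferInstance).smul_measure ENNReal.ofReal_ne_top]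
  refine Finset.sum_congr rfl fun i _ => ?_
  rw [integral_smul_measure, ENNReal.toReal_ofReal (hμ.weight_pos i).le, smul_eq_mul,
    integral_map (hmeas i).aemeasurable u.continuous.aestronglyMeasurable]

/-- The scaling of the Laplacian: `Δ_μ (u ∘ F i) = r i · ν i · (Δ_μ u) ∘ F i`. -/
theorem HasLaplacian.comp_cellMap [MeasurableSpace X] [BorelSpace X] {ν : Fin s → ℝ}
    {μ : Measure S.K} (hμ : S.IsSelfSimilarMeasure ν μ) {u f : C(S.K, ℝ)}
    (h : D.HasLaplacian μ u f) (i : Fin s) :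
    D.HasLaplacian μ (u.comp (S.cellMap i)) ((D.r i * ν i) • f.comp (S.cellMap i)) := by
  have hr := D.r_pos i
  have hν := hμ.weight_pos i
  intro ε hε
  obtain ⟨M, hM⟩ := h (ε / (D.r i * ν i)) (by positivity)
  refine ⟨M, fun m hm p ⟨hpm, hp⟩ => ?_⟩
  obtain ⟨ψ, hψ, hle⟩ := hM (m + 1) (by omega) (S.map i p)
    ⟨S.mem_V_succ.2 ⟨i, p, hpm, rfl⟩, fun h0 => hp (S.mem_V0_of_map_mem_V0 h0)⟩
  refine ⟨ψ.comp (S.cellMap i), hψ.comp_cellMap D hp, ?_⟩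
  have hI : ∫ x, ψ x ∂μ = ν i * ∫ x, ψ (S.map i x) ∂μ := by
    rw [integral_eq_sum hμ, Finset.sum_eq_single i]
    · intro j _ hj
      have h0 : ∀ x, ψ (S.map j x) = 0 :=
        DFunLike.congr_fun (hψ.comp_cellMap_eq_zero D hj hp)
      simp [h0]
    · exact fun hi => absurd (Finset.mem_univ i) hi
  rw [D.levelLaplacian_succ m u i hp, hI, le_div_iff₀' (by positivity)] at hle
  have e : (∫ x, ψ (S.map i x) ∂μ)⁻¹ * D.levelLaplacian m (u ∘ S.map i) p -
      D.r i * ν i * f (S.map i p) = D.r i * ν i * ((ν i * ∫ x, ψ (S.map i x) ∂μ)⁻¹ *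
        ((D.r i)⁻¹ * D.levelLaplacian m (u ∘ S.map i) p) - f (S.map i p)) := by
    rw [mul_inv]
    field_simp
  have habs := abs_of_pos (mul_pos hr hν)
  rw [← habs, ← abs_mul, ← e] at hle
  exact hle

end RegularHarmonicStructure

end PCFSet

namespace PCFSet

variable {X : Type*} [MetricSpace X] {s : ℕ} (S : PCFSet X s)

/-! ### Extreme sets and cells -/

theorem finite_V_one : (S.V 1).Finite :=
  finite_iUnion fun _ => (S.finite_postCriticalSet.image S.coding).image _

variable {S}

theorem extremeCount_zero : S.extremeCount 0 = 0 := by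
  rw [extremeCount, encard_eq_zero, eq_empty_iff_forall_notMem]
  have key : ∀ A c, ¬ S.IsInteriorLevelComponent 0 A c := by
    rintro A c ⟨⟨x, hx, hA⟩, hV⟩
    have hu : ((0 : C(S.K, ℝ)) ⁻¹' {c} : Set S.K) = univ := eq_univ_of_forall fun y => hx
    rw [hu, connectedComponentIn_univ, PreconnectedSpace.connectedComponent_eq_univ] at hA
    rw [hA, univ_inter] at hV
    exact S.V0_nonempty.ne_empty hV
  rintro A ⟨c, h | h⟩
  · exact key A c h.1
  · exact key A c h.1

/-- An interior level component that avoids the vertices of level one lies in a single cell: these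
vertices contain all the common points of distinct cells. -/
theorem IsInteriorLevelComponent.exists_cell {u : C(S.K, ℝ)} {A : Set S.K} {c : ℝ}
    (h : S.IsInteriorLevelComponent u A c) (hA : A ∩ S.V 1 = ∅) :
    ∃ i B, S.map i '' B = A ∧ S.IsInteriorLevelComponent (u.comp (S.cellMap i)) B c := by
  obtain ⟨⟨x, hx, hAx⟩, -⟩ := h
  have hV : ∀ y ∈ S.V0, ∀ i, S.map i y ∉ A := fun y hy i hyA =>
    (hA ▸ (⟨hyA, S.mem_V_succ.2 ⟨i, y, S.mem_V_zero.2 hy, rfl⟩⟩ : S.map i y ∈ A ∩ S.V 1) :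
      S.map i y ∈ (∅ : Set S.K))
  obtain ⟨i, y, rfl⟩ := S.exists_map_eq x
  have hxA : S.map i y ∈ A := hAx ▸ mem_connectedComponentIn hx
  have hpre : IsPreconnected A := hAx ▸ isPreconnected_connectedComponentIn
  have hAc : A ⊆ u ⁻¹' {c} := hAx ▸ connectedComponentIn_subset _ _
  have hsub : A ⊆ range (S.map i) := by
    by_contra hns
    obtain ⟨z, hzA, hzi⟩ := not_subset.1 hns
    obtain ⟨j, z', rfl⟩ := S.exists_map_eq z
    have hj : j ≠ i := fun e => hzi (e ▸ ⟨z', rfl⟩)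
    let T : Set S.K := ⋃ k ∈ {k | k ≠ i}, range (S.map k)
    have hT : IsClosed T := (toFinite _).isClosed_biUnion fun k _ => S.isClosed_range_map k
    have hcov : A ⊆ range (S.map i) ∪ T := fun a _ => by
      obtain ⟨k, b, rfl⟩ := S.exists_map_eq a
      by_cases hk : k = i
      · exact Or.inl (hk ▸ ⟨b, rfl⟩)
      · exact Or.inr (mem_biUnion (show k ∈ {k | k ≠ i} from hk) ⟨b, rfl⟩)
    obtain ⟨a, haA, ⟨b, rfl⟩, haT⟩ := isPreconnected_closed_iff.1 hpre _ T
      (S.isClosed_range_map i) hT hcov ⟨_, hxA, y, rfl⟩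
      ⟨_, hzA, mem_biUnion (show j ∈ {k | k ≠ i} from hj) ⟨z', rfl⟩⟩
    obtain ⟨k, hk, b', hb'⟩ := mem_iUnion₂.1 haT
    exact hV b (S.mem_V0_of_map_eq_map (Ne.symm hk) hb'.symm) i haA
  have himg : S.map i '' (S.map i ⁻¹' A) = A := image_preimage_eq_of_subset hsub
  refine ⟨i, S.map i ⁻¹' A, himg, ⟨y, hx, ?_⟩, ?_⟩
  · apply Subset.antisymm
    · refine IsPreconnected.subset_connectedComponentIn ?_ hxA fun b hb => hAc hb
      rw [← (S.isClosedEmbedding_map i).isInducing.isPreconnected_image, himg]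
      exact hpre
    · rw [← image_subset_iff, hAx]
      refine (isPreconnected_connectedComponentIn.image _
        (S.continuous_map i).continuousOn).subset_connectedComponentIn ⟨y, ?_, rfl⟩ ?_
      · exact mem_connectedComponentIn hx
      · rw [image_subset_iff]
        exact connectedComponentIn_subset _ _
  · exact eq_empty_iff_forall_notMem.2 fun b ⟨hb, hb0⟩ => hV b hb0 i hb

theorem map_mem_thickening {i : Fin s} {δ : ℝ} {B : Set S.K} {p : S.K}
    (hp : p ∈ Metric.thickening δ B) : S.map i p ∈ Metric.thickening δ (S.map i '' B) := by
  obtain ⟨c, -, hc1, hc⟩ := S.exists_ratio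
  obtain ⟨b, hb, hd⟩ := Metric.mem_thickening_iff.1 hp
  refine Metric.mem_thickening_iff.2 ⟨_, mem_image_of_mem _ hb, lt_of_le_of_lt ?_ hd⟩
  exact (hc i p b).trans (mul_le_of_le_one_left dist_nonneg hc1.le)

theorem IsExtremeSet.exists_cell {u : C(S.K, ℝ)} {A : Set S.K} (h : S.IsExtremeSet u A)
    (hA : A ∩ S.V 1 = ∅) :
    ∃ i B, S.map i '' B = A ∧ S.IsExtremeSet (u.comp (S.cellMap i)) B := by
  obtain ⟨c, ⟨h, δ, hδ, hle⟩ | ⟨h, δ, hδ, hle⟩⟩ := h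
  · obtain ⟨i, B, rfl, hB⟩ := h.exists_cell hA
    exact ⟨i, B, rfl, c, Or.inl ⟨hB, δ, hδ, fun p hp => hle _ (map_mem_thickening hp)⟩⟩
  · obtain ⟨i, B, rfl, hB⟩ := h.exists_cell hA
    exact ⟨i, B, rfl, c, Or.inr ⟨hB, δ, hδ, fun p hp => hle _ (map_mem_thickening hp)⟩⟩

theorem IsExtremeSet.eq_connectedComponentIn {u : C(S.K, ℝ)} {A : Set S.K}
    (h : S.IsExtremeSet u A) {a : S.K} (ha : a ∈ A) :
    A = connectedComponentIn (u ⁻¹' {u a}) a := by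
  have key : ∀ c, S.IsInteriorLevelComponent u A c →
      A = connectedComponentIn (u ⁻¹' {u a}) a := by
    rintro c ⟨⟨x, -, rfl⟩, -⟩
    have hc : u a = c := connectedComponentIn_subset (u ⁻¹' {c}) x ha
    rw [hc]
    exact connectedComponentIn_eq ha
  obtain ⟨c, h | h⟩ := h
  · exact key c h.1
  · exact key c h.1

/-- Extreme sets are pairwise disjoint, so those meeting `V₁` are at most as many as its points;
any other one is the image of an extreme set of some `u ∘ F i`. -/
theorem extremeCount_le (u : C(S.K, ℝ)) :
    S.extremeCount u ≤ ∑ i, S.extremeCount (u.comp (S.cellMap i)) + (S.V 1).encard := by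
  let E : Set (Set S.K) := {A | S.IsExtremeSet u A ∧ (A ∩ S.V 1).Nonempty}
  let G : Fin s → Set (Set S.K) := fun i =>
    (S.map i '' ·) '' {B | S.IsExtremeSet (u.comp (S.cellMap i)) B}
  have hsub : {A | S.IsExtremeSet u A} ⊆ (⋃ i, G i) ∪ E := fun A hA => by
    rcases (A ∩ S.V 1).eq_empty_or_nonempty with h | h
    · obtain ⟨i, B, hB, hext⟩ := IsExtremeSet.exists_cell hA h
      exact Or.inl (mem_iUnion.2 ⟨i, B, hext, hB⟩)
    · exact Or.inr ⟨hA, h⟩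
  have hE : E.encard ≤ (S.V 1).encard := by
    have hch : ∀ A : Set S.K, ∃ a, A ∈ E → a ∈ A ∩ S.V 1 := fun A => by
      by_cases hA : A ∈ E
      · exact ⟨hA.2.some, fun _ => hA.2.some_mem⟩
      · exact ⟨Classical.arbitrary _, fun h => absurd h hA⟩
    choose a ha using hch
    refine encard_le_encard_of_injOn (f := a) (fun A hA => (ha A hA).2) fun A hA B hB hAB => ?_
    rw [hA.1.eq_connectedComponentIn (ha A hA).1, hB.1.eq_connectedComponentIn (ha B hB).1, hAB]
  calc S.extremeCount u ≤ ((⋃ i, G i) ∪ E).encard := encard_le_encard hsub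
    _ ≤ (⋃ i, G i).encard + E.encard := encard_union_le _ _
    _ ≤ ∑ i, S.extremeCount (u.comp (S.cellMap i)) + (S.V 1).encard :=
      add_le_add ((encard_iUnion_le_of_fintype G).trans
        (Finset.sum_le_sum fun i _ => encard_image_le _ _)) hE

/-! ### The counting function -/

namespace RegularHarmonicStructure

variable (D : S.RegularHarmonicStructure)

theorem gamma_pos [MeasurableSpace X] {ν : Fin s → ℝ} {μ : Measure S.K}
    (hμ : S.IsSelfSimilarMeasure ν μ) (i : Fin s) : 0 < D.gamma ν i :=
  Real.sqrt_pos.2 (mul_pos (D.r_pos i) (hμ.weight_pos i))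

theorem gamma_sq [MeasurableSpace X] {ν : Fin s → ℝ} {μ : Measure S.K}
    (hμ : S.IsSelfSimilarMeasure ν μ) (i : Fin s) : D.gamma ν i ^ 2 = D.r i * ν i :=
  Real.sq_sqrt (mul_pos (D.r_pos i) (hμ.weight_pos i)).le

theorem gamma_lt_one [MeasurableSpace X] {ν : Fin s → ℝ} {μ : Measure S.K}
    (hμ : S.IsSelfSimilarMeasure ν μ) (i : Fin s) : D.gamma ν i < 1 := by
  rw [← sq_lt_one_iff₀ (D.gamma_pos hμ i).le, D.gamma_sq hμ]
  exact mul_lt_one_of_nonneg_of_lt_one_left (D.r_pos i).le (D.r_lt_one i) (hμ.weight_lt_one i).le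

variable {D}

theorem IsEigenfunction.comp_cellMap [MeasurableSpace X] [BorelSpace X] {ν : Fin s → ℝ}
    {μ : Measure S.K} (hμ : S.IsSelfSimilarMeasure ν μ) {lam : ℝ} {u : C(S.K, ℝ)}
    (h : D.IsEigenfunction μ lam u) {i : Fin s} (hi : u.comp (S.cellMap i) ≠ 0) :
    D.IsEigenfunction μ (D.gamma ν i ^ 2 * lam) (u.comp (S.cellMap i)) := by
  obtain ⟨-, f, hf, he⟩ := h
  refine ⟨hi, _, hf.comp_cellMap D hμ i, fun x hx => ?_⟩
  have h1 := he (S.map i x) fun h0 => hx (S.mem_V0_of_map_mem_V0 h0)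
  rw [D.gamma_sq hμ]
  show -(D.r i * ν i * f (S.map i x)) = D.r i * ν i * lam * u (S.map i x)
  linear_combination D.r i * ν i * h1

theorem extremumCountingFunction_le_sum [MeasurableSpace X] [BorelSpace X] {ν : Fin s → ℝ}
    {μ : Measure S.K} (hμ : S.IsSelfSimilarMeasure ν μ) (x : ℝ) :
    D.extremumCountingFunction μ x ≤
      ∑ i, D.extremumCountingFunction μ (D.gamma ν i ^ 2 * x) + (S.V 1).encard := by
  refine iSup_le fun lam => iSup₂_le fun u ⟨h0, hx, hu⟩ => (extremeCount_le u).trans ?_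
  gcongr with i
  by_cases hi : u.comp (S.cellMap i) = 0
  · rw [hi, extremeCount_zero]
    exact zero_le
  · exact le_iSup_of_le (D.gamma ν i ^ 2 * lam) (le_iSup₂_of_le (u.comp (S.cellMap i))
      ⟨mul_nonneg (sq_nonneg _) h0, mul_le_mul_of_nonneg_left hx (sq_nonneg _),
        hu.comp_cellMap hμ hi⟩ le_rfl)

end RegularHarmonicStructure

end PCFSet

/-- A renewal inequality. If `T x ≤ ∑ i, T (γ i ^ 2 * x) + c` and `T ≤ 1` below `lam₀`, then `T x`
grows at most like `x ^ (d / 2)`, where `∑ i, γ i ^ d = 1`. -/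
theorem exists_forall_le_mul_rpow_of_le_sum {ι : Type*} [Fintype ι] {γ : ι → ℝ}
    (hcard : 1 < Fintype.card ι) (hγ : ∀ i, 0 < γ i) (hγ1 : ∀ i, γ i < 1) {d : ℝ}
    (hd : ∑ i, γ i ^ d = 1) {T : ℝ → ℕ∞} {c : ℕ} {lam₀ : ℝ} (hlam : 0 < lam₀)
    (hT : ∀ x, T x ≤ ∑ i, T (γ i ^ 2 * x) + c) (hT1 : ∀ x < lam₀, T x ≤ 1) :
    ∃ A : ℝ, 0 ≤ A ∧ ∀ x, lam₀ ≤ x → ∃ n : ℕ, T x ≤ n ∧ (n : ℝ) ≤ A * x ^ (d / 2) := by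
  have : Nonempty ι := Fintype.card_pos_iff.1 (by omega)
  have hcard' : (1 : ℝ) < Fintype.card ι := by exact_mod_cast hcard
  have hd0 : 0 < d := by
    by_contra! hd0
    have h1 : (∑ _i : ι, (1 : ℝ)) ≤ ∑ i, γ i ^ d := Finset.sum_le_sum fun i _ =>
      Real.one_le_rpow_of_pos_of_le_one_of_nonpos (hγ i) (hγ1 i).le hd0
    rw [hd, Finset.sum_const, Finset.card_univ, nsmul_one] at h1
    linarith
  obtain ⟨i₀, hmin⟩ := Finite.exists_min γ
  obtain ⟨i₁, hmax⟩ := Finite.exists_max γ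
  -- `B` is the constant for which `A * x ^ (d / 2) - B` solves the recursion with equality.
  let B : ℝ := c / (Fintype.card ι - 1)
  have hB0 : 0 ≤ B := div_nonneg (Nat.cast_nonneg _) (by linarith)
  have hB : B * (Fintype.card ι - 1) = c := div_mul_cancel₀ _ (by linarith)
  let a : ℝ := γ i₀ ^ 2 * lam₀
  have ha : 0 < a := mul_pos (pow_pos (hγ i₀) 2) hlam
  have had : 0 < a ^ (d / 2) := Real.rpow_pos_of_pos ha _
  let A : ℝ := (1 + B) / a ^ (d / 2)
  have hA : 0 ≤ A := div_nonneg (by linarith) had.le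
  have base : ∀ x, a ≤ x → x < lam₀ → ∃ n : ℕ, T x ≤ n ∧ (n : ℝ) ≤ A * x ^ (d / 2) - B := by
    intro x hax hx
    refine ⟨1, by exact_mod_cast hT1 x hx, ?_⟩
    have h1 : A * a ^ (d / 2) = 1 + B := div_mul_cancel₀ _ had.ne'
    have h2 : A * a ^ (d / 2) ≤ A * x ^ (d / 2) :=
      mul_le_mul_of_nonneg_left (Real.rpow_le_rpow ha.le hax (by linarith)) hA
    push_cast
    linarith
  have main : ∀ (k : ℕ) (x : ℝ), a ≤ x → (γ i₁ ^ 2) ^ k * x < lam₀ →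
      ∃ n : ℕ, T x ≤ n ∧ (n : ℝ) ≤ A * x ^ (d / 2) - B := by
    intro k
    induction k with
    | zero =>
      intro x hax hx
      exact base x hax (by simpa using hx)
    | succ k ih =>
      intro x hax hx
      rcases lt_or_ge x lam₀ with hlt | hge
      · exact base x hax hlt
      have hx0 : 0 < x := ha.trans_le hax
      have hstep : ∀ i, ∃ n : ℕ, T (γ i ^ 2 * x) ≤ n ∧
          (n : ℝ) ≤ A * (γ i ^ 2 * x) ^ (d / 2) - B := fun i => by
        have h1 : γ i₀ ^ 2 ≤ γ i ^ 2 := pow_le_pow_left₀ (hγ i₀).le (hmin i) 2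
        have h2 : γ i ^ 2 ≤ γ i₁ ^ 2 := pow_le_pow_left₀ (hγ i).le (hmax i) 2
        refine ih _ (mul_le_mul h1 hge hlam.le (sq_nonneg _)) (lt_of_le_of_lt ?_ hx)
        rw [pow_succ (γ i₁ ^ 2), mul_assoc]
        gcongr
      choose n hn hn' using hstep
      refine ⟨∑ i, n i + c, (hT x).trans ?_, ?_⟩
      · push_cast
        gcongr with i
        exact hn i
      · have hpow : ∀ i, (γ i ^ 2 * x) ^ (d / 2) = γ i ^ d * x ^ (d / 2) := fun i => by
          rw [Real.mul_rpow (sq_nonneg _) hx0.le, ← Real.rpow_natCast, ← Real.rpow_mul (hγ i).le]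
          congr 2
          push_cast
          ring
        have hsum : ∑ i, (A * (γ i ^ 2 * x) ^ (d / 2) - B) =
            A * x ^ (d / 2) - Fintype.card ι * B := by
          simp only [hpow]
          rw [Finset.sum_sub_distrib, ← Finset.mul_sum, ← Finset.sum_mul, hd, one_mul,
            Finset.sum_const, Finset.card_univ, nsmul_eq_mul]
        have h3 := Finset.sum_le_sum fun i (_ : i ∈ Finset.univ) => hn' i
        rw [hsum] at h3
        push_cast
        linarith
  refine ⟨A, hA, fun x hx => ?_⟩
  have hx0 : 0 < x := hlam.trans_le hx
  obtain ⟨k, hk⟩ := exists_pow_lt_of_lt_one (div_pos hlam hx0)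
    (pow_lt_one₀ (hγ i₁).le (hγ1 i₁) two_ne_zero)
  have hax : a ≤ x :=
    (mul_le_of_le_one_left hlam.le (pow_le_one₀ (hγ i₀).le (hγ1 i₀).le)).trans hx
  obtain ⟨n, hn, hn'⟩ := main k x hax ((lt_div_iff₀ hx0).1 hk)
  exact ⟨n, hn, hn'.trans (by linarith)⟩

theorem proposition1p2 {X : Type*} [MetricSpace X] [CompleteSpace X] [MeasurableSpace X]
    [BorelSpace X] {s : ℕ} (S : PCFSet X s) (D : S.RegularHarmonicStructure)
    (ν : Fin s → ℝ) (μ : Measure S.K) (hμ : S.IsSelfSimilarMeasure ν μ)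
    (dS : ℝ) (hdS : D.IsSpectralExponent ν dS) (hA : D.ConditionA μ) :
    Filter.limsup
      (fun x : ℝ => (D.extremumCountingFunction μ x : ℝ≥0∞) / ENNReal.ofReal (x ^ (dS / 2)))
      Filter.atTop < ⊤ := by
  obtain ⟨lam₀, hlam, hN⟩ := hA
  have hs := S.two_le
  obtain ⟨A, hA0, hA⟩ := exists_forall_le_mul_rpow_of_le_sum (T := D.extremumCountingFunction μ)
    (c := (S.V 1).ncard) (by rw [Fintype.card_fin]; omega) (D.gamma_pos hμ) (D.gamma_lt_one hμ)
    hdS hlam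
    (fun x => by
      rw [S.finite_V_one.cast_ncard_eq]
      exact PCFSet.RegularHarmonicStructure.extremumCountingFunction_le_sum hμ x)
    (fun x hx => iSup_le fun lam => iSup₂_le fun u ⟨h0, h1, hu⟩ =>
      hN lam u h0 (h1.trans_lt hx) hu)
  refine lt_of_le_of_lt (limsup_le_of_le (h := ?_)) (ENNReal.ofReal_lt_top (r := A))
  filter_upwards [eventually_ge_atTop lam₀] with x hx
  obtain ⟨n, hn, hn'⟩ := hA x hx
  refine ENNReal.div_le_of_le_mul ?_
  calc (D.extremumCountingFunction μ x : ℝ≥0∞) ≤ ((n : ℕ∞) : ℝ≥0∞) := by exact_mod_cast hn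
    _ = ENNReal.ofReal n := by simp
    _ ≤ ENNReal.ofReal (A * x ^ (dS / 2)) := ENNReal.ofReal_le_ofReal hn'
    _ = ENNReal.ofReal A * ENNReal.ofReal (x ^ (dS / 2)) := ENNReal.ofReal_mul hA0
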